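/- Let $\mathbb F_q$ be a finite field with $q$ elements, $n$ a positive integer, $G=\mathsf{GL}_n(\mathbb F_q)$, and $B$ (resp. $B^-$) the subgroup of upper (resp. lower) triangular matrices in $G$. Let $\mathfrak F$ be the set of complete flags $(V_0\subseteq V_1\subseteq\cdots\subseteq V_n)$ in $\mathbb F_q^n$, $\dim V_i=i$, identified with $G/B$ by letting $V_i$ be the span of the first $i$ columns of $g$ for the coset $gB$. For $\pi\in\mathfrak S_n$ let $[\pi]\subseteq\mathfrak F$ be the set of flags of the double coset $B^-\pi B$ (where $\pi$ is regarded as the permutation matrix whose $j$-th column is $e_{\pi_j}$), and let $F_\pi\in[\pi]$ be the flag with $V_i=\langle e_{\pi_1},\dots,e_{\pi_i}\rangle$. Let ${\sf x}=(x_1,\dots,x_n)$ be either positive real numbers, with $K=\mathbb R$, or indeterminates, with $K=\mathbb C(x_1,\dots,x_n)$. The $q$-Tsetlin library on flags is the $K$-linear operator on $K[\mathfrak F]$, acting on the right, $$\mathcal T_{G/B}(q,{\sf x})=\sum_{i=1}^n T_{i-1}\cdots T_1\,\mathcal X ,$$ where $(V_0\subseteq\cdots\subseteq V_n)\cdot T_i$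 is the sum of all flags $(V_0\subseteq\cdots\subseteq V_{i-1}\subseteq W\subseteq V_{i+1}\subseteq\cdots\subseteq V_n)$ with $W\ne V_i$, and $\mathcal X$ multiplies a flag with $V_1=\langle e_i+\sum_{k>i}c_ke_k\rangle$ by $x_i/q^{n-i}$. Call $\Psi\in K[\mathfrak F]$ stationary if $\Psi\cdot\mathcal T_{G/B}(q,{\sf x})=(x_1+\cdots+x_n)\,\Psi$. For $\pi\in\mathfrak S_n$, $1\le k\le n$ and $s\in\{1,\dots,n\}$ put $b_k(s)=\#\{t\in\{\pi_1,\dots,\pi_{k-1}\}\mid t>s\}$ and $$f(\pi_1,\dots,\pi_k)=\sum_{\substack{s\in\{\pi_1,\dots,\pi_k\}\\ s\le\pi_k}}\frac{x_s}{q^{\,n-s-b_k(s)}(x_1+\cdots+x_n)}\,(q-1)^{\chi(s<\pi_k)},$$ where $\chi(s<\pi_k)$ is $1$ if $s<\pi_k$ and $0$ otherwise. Then, in both cases, there is a stationary $\Psi=\sum_F\Psi_F\,F$ such that 1. $\Psi_F=\Psi_{F'}$ whenever $F,F'\in[\pi]$ for some $\pi\in\mathfrak S_n$; 2. for every $\pi\in\mathfrak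 S_n$, $$\Psi_{F_\pi}=\prod_{k=1}^n\frac{f(\pi_1,\dots,\pi_k)}{x_1+\cdots+x_n-\sum_{s\in\{\pi_1,\dots,\pi_{k-1}\}}\dfrac{x_s}{q^{\,n-s-b_k(s)}}},$$ where all denominators are nonzero; 3. every stationary element of $K[\mathfrak F]$ is a $K$-multiple of $\Psi$. If the $x_i$ are positive real numbers, then moreover $\Psi_F\ge0$ for all $F\in\mathfrak F$, and if in addition $x_1+\cdots+x_n=1$, then $\sum_{F\in\mathfrak F}\Psi_F=1$ and $\Psi$ is the only stationary element of $\mathbb R[\mathfrak F]$ whose entries sum to $1$. -/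

import Mathlib

open scoped BigOperators

noncomputable section

namespace QTsetlin

variable (F : Type*) [Field F] (n : ℕ)

/-- Complete flags `V 0 ≤ V 1 ≤ ... ≤ V n` in `F ^ n`, with `dim (V i) = i`. -/
@[ext]
structure CompleteFlag where
  V : Fin (n + 1) → Submodule F (Fin n → F)
  mono : Monotone V
  finrank_eq : ∀ i, Module.finrank F (V i) = (i : ℕ)

instance [Finite F] : Finite (CompleteFlag F n) :=
  Finite.of_injective CompleteFlag.V fun _ _ h => CompleteFlag.ext h

instance [Finite F] : Fintype (CompleteFlag F n) := Fintype.ofFinite _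

variable {F n}

/-! ### Flags of invertible matrices, and double cosets -/

/-- The flag of the coset `gB`: its `i`-th space is spanned by the first `i` columns of `g`. -/
def flagOf (g : GL (Fin n) F) : CompleteFlag F n where
  V i := Submodule.span F (g.1.col '' {j : Fin n | (j : ℕ) < (i : ℕ)})
  mono _ _ h := Submodule.span_mono (Set.image_mono fun j (hj : (j : ℕ) < _) =>
    show (j : ℕ) < _ from lt_of_lt_of_le hj h)
  finrank_eq i := by
    have hli : LinearIndependent F g.1.col :=
      Matrix.linearIndependent_cols_iff_isUnit.mpr g.isUnit
    rw [Set.image_eq_range]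
    have h2 : LinearIndependent F
        (fun j : {j : Fin n | (j : ℕ) < (i : ℕ)} => g.1.col j) :=
      hli.comp _ Subtype.val_injective
    rw [finrank_span_eq_card h2]
    have : Fintype.card {j : Fin n | (j : ℕ) < (i : ℕ)} =
        Fintype.card (Fin (i : ℕ)) := by
      refine Fintype.card_congr
        { toFun := fun j => ⟨j.1, j.2⟩
          invFun := fun j => ⟨⟨j, by have := i.2; have := j.2; omega⟩, j.2⟩
          left_inv := fun _ => rfl
          right_inv := fun _ => rfl }
    rw [this, Fintype.card_fin]

variable (F n) in
/-- Invertible upper triangular matrices. -/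
def upperB : Set (GL (Fin n) F) := {g | ∀ i j : Fin n, j < i → g.1 i j = 0}

variable (F n) in
/-- Invertible lower triangular matrices. -/
def lowerB : Set (GL (Fin n) F) := {g | ∀ i j : Fin n, i < j → g.1 i j = 0}

variable (F) in
/-- The permutation matrix of `π`, whose `j`-th column is the basis vector `e_{π j}`. -/
def permGL (π : Equiv.Perm (Fin n)) : GL (Fin n) F where
  val := π⁻¹.permMatrix F
  inv := π.permMatrix F
  val_inv := by rw [← Matrix.permMatrix_mul]; simp
  inv_val := by rw [← Matrix.permMatrix_mul]; simp

theorem permGL_apply (π : Equiv.Perm (Fin n)) (i j : Fin n) :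
    (permGL F π).1 i j = if i = π j then 1 else 0 := by
  simp [permGL, Equiv.Perm.permMatrix, PEquiv.toMatrix_apply, Equiv.symm_apply_eq]

variable (F) in
/-- The distinguished flag `F_π` of the double coset of `π`. -/
def permFlag (π : Equiv.Perm (Fin n)) : CompleteFlag F n := flagOf (permGL F π)

variable (F) in
/-- The double coset `[π] = B⁻ π B`, as a set of flags (i.e. of cosets `gB`). -/
def cell (π : Equiv.Perm (Fin n)) : Set (CompleteFlag F n) :=
  flagOf '' DoubleCoset.doubleCoset (permGL F π) (lowerB F n) (upperB F n)

/-! ### The `q`-Tsetlin library on flags -/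

variable [Fintype F] {K : Type*} [Field K]

open Classical in
variable (F n K) in
/-- Right action of the Hecke generator `T_i` (`1 ≤ i ≤ n - 1`) on `K[flags]`: a flag is sent to
the sum of all other flags that differ from it only in the `i`-dimensional subspace. -/
def heckeT (i : ℕ) : (CompleteFlag F n →₀ K) →ₗ[K] (CompleteFlag F n →₀ K) :=
  Finsupp.linearCombination K fun V : CompleteFlag F n =>
    ∑ W : CompleteFlag F n with W ≠ V ∧ ∀ j : Fin (n + 1), (j : ℕ) ≠ i → W.V j = V.V j,
      Finsupp.single W 1

variable (F n K) in
/-- Right action of `T_m T_{m-1} ⋯ T_1`: the generator `T_m` acts first, and `T_1` last. -/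
def heckeProd : ℕ → (CompleteFlag F n →₀ K) →ₗ[K] (CompleteFlag F n →₀ K)
  | 0 => LinearMap.id
  | m + 1 => heckeProd m ∘ₗ heckeT F n K (m + 1)

/-- The line `L` is spanned by a vector `e_i + ∑_{k > i} c_k e_k`. -/
def HasLead (L : Submodule F (Fin n → F)) (i : Fin n) : Prop :=
  ∃ c : Fin n → F,
    L = Submodule.span F {Pi.single i 1 + ∑ k ∈ Finset.Ioi i, c k • Pi.single k (1 : F)}

open Classical in
/-- The weight `x_i / q ^ (n - i)` of a line with leading term `e_i`, where `q = |F|`. The index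
`i : Fin n` stands for `i + 1` in `{1, ..., n}`. A line has exactly one leading term. -/
def lineWeight (x : Fin n → K) (L : Submodule F (Fin n → F)) : K :=
  ∑ i : Fin n with HasLead L i, x i / (Fintype.card F : K) ^ (n - ((i : ℕ) + 1))

variable (F) in
/-- The diagonal operator that scales a flag by the weight of its line `V 1`. -/
def weightX (x : Fin n → K) : (CompleteFlag F n →₀ K) →ₗ[K] (CompleteFlag F n →₀ K) :=
  Finsupp.linearCombination K fun V : CompleteFlag F n =>
    Finsupp.single V (lineWeight x (V.V 1))

variable (F) in
/-- The `q`-Tsetlin library on flags: the right action of `∑_{i=1}^n T_{i-1} ⋯ T_1`, followed by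
the weight operator. -/
def qTsetlin (x : Fin n → K) : (CompleteFlag F n →₀ K) →ₗ[K] (CompleteFlag F n →₀ K) :=
  weightX F x ∘ₗ ∑ m ∈ Finset.range n, heckeProd F n K m

variable (F) in
/-- `Ψ · T(q, x) = (x_1 + ⋯ + x_n) Ψ`. -/
def IsStationary (x : Fin n → K) (Ψ : CompleteFlag F n →₀ K) : Prop :=
  qTsetlin F x Ψ = (∑ i, x i) • Ψ

/-! ### The factors of the explicit formula -/

/-- `b_k(s)`, the number of `t ∈ {π_1, ..., π_{k-1}}` with `t > s`. -/
def bStat (π : Equiv.Perm (Fin n)) (k s : Fin n) : ℕ :=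
  (((Finset.Iio k).image π).filter fun t => s < t).card

variable (F) in
/-- `x_s / q ^ (n - s - b_k(s))`, where `q = |F|` and `s : Fin n` stands for `s + 1`. -/
def scaledRate (x : Fin n → K) (π : Equiv.Perm (Fin n)) (k s : Fin n) : K :=
  x s / (Fintype.card F : K) ^ ((n : ℤ) - ((s : ℤ) + 1) - (bStat π k s : ℤ))

variable (F) in
/-- `f(π_1, ..., π_k)`. -/
def numFactor (x : Fin n → K) (π : Equiv.Perm (Fin n)) (k : Fin n) : K :=
  ∑ s ∈ (Finset.Iic k).image π with s ≤ π k,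
    scaledRate F x π k s / (∑ i, x i) * ((Fintype.card F : K) - 1) ^ (if s < π k then 1 else 0)

variable (F) in
/-- `x_1 + ⋯ + x_n - ∑_{s ∈ {π_1, ..., π_{k-1}}} x_s / q ^ (n - s - b_k(s))`. -/
def denFactor (x : Fin n → K) (π : Equiv.Perm (Fin n)) (k : Fin n) : K :=
  (∑ i, x i) - ∑ s ∈ (Finset.Iio k).image π, scaledRate F x π k s

end QTsetlin

end

/-! Write `X` for the sum of the `x_i`, and give the line with leading term `e_i` the weight `x_i /
q ^ (n - i)`. The product `T_m ⋯ T_1` sends a flag `V` to the sum of the flags obtained by moving to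
the front a line of `V_{m+1}` outside `V_m` (`heckeProd_single`). Hence the operator is a
random-to-front chain: every line is moved to the front with its weight (`qTsetlin_single`).

Let `w(U)` be the total weight of the lines of `U`. Fix a flag `W`, and for a stationary `Φ` let
`a_k` be the sum of `Φ V` over those `V` for which all `W_k + V_j` are spaces of `W`. Then `a_0 = Φ
W`, while `a_n` is the sum of all entries. Following the last line moved gives `(X - w(W_k)) a_k =
(w(W_{k+1}) - w(W_k)) a_{k+1}` (`IsStationary.step`), so `Φ` is an explicit product times its total.
This is uniqueness; existence follows because the operator multiplies totals by `X`, which makes `X`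
an eigenvalue.

Lower triangular matrices preserve leading positions, hence `w`, so entries are constant on cells.
On coordinate flags `w` is counted directly (`leadCount_coordSpace`), which gives the stated
factors. -/

noncomputable section

namespace QTsetlin

variable {F : Type*} [Field F] {n : ℕ}

/-! ### Flags indexed by natural numbers -/

namespace CompleteFlag

/-- The space `V i` of a flag, for a natural number `i`, constant from `i = n` on. -/
def at' (V : CompleteFlag F n) (i : ℕ) : Submodule F (Fin n → F) :=
  V.V ⟨min i n, by omega⟩

theorem at_coe (V : CompleteFlag F n) (i : Fin (n + 1)) : V.at' i = V.V i := by
  have : min (i : ℕ) n = i := by omega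
  simp [at', this]

theorem at_mono (V : CompleteFlag F n) : Monotone V.at' := fun i j h =>
  V.mono (by rw [Fin.le_def]; simp only; omega)

theorem finrank_at (V : CompleteFlag F n) (i : ℕ) : Module.finrank F (V.at' i) = min i n :=
  V.finrank_eq _

theorem at_zero (V : CompleteFlag F n) : V.at' 0 = ⊥ :=
  Submodule.finrank_eq_zero.mp (by simp [finrank_at])

theorem at_of_le (V : CompleteFlag F n) {i : ℕ} (h : n ≤ i) : V.at' i = ⊤ :=
  Submodule.eq_top_of_finrank_eq (by simp [finrank_at, h])

theorem ext_at {V W : CompleteFlag F n} (h : ∀ i, V.at' i = W.at' i) : V = W := by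
  ext1
  funext i
  rw [← at_coe, ← at_coe, h]

theorem at_ne_top (V : CompleteFlag F n) {i : ℕ} (h : i < n) : V.at' i ≠ ⊤ := fun e => by
  have := V.finrank_at i
  rw [e, finrank_top, Module.finrank_fin_fun] at this
  omega

/-- A flag from a sequence of subspaces indexed by natural numbers. -/
def ofNat (U : ℕ → Submodule F (Fin n → F)) (hm : Monotone U)
    (hr : ∀ i ≤ n, Module.finrank F (U i) = i) : CompleteFlag F n where
  V i := U i
  mono _ _ h := hm h
  finrank_eq i := hr i (by omega)

theorem at_ofNat (U : ℕ → Submodule F (Fin n → F)) (hm : Monotone U)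
    (hr : ∀ i ≤ n, Module.finrank F (U i) = i) (i : ℕ) (hi : i ≤ n) :
    (ofNat U hm hr).at' i = U i := by
  simp [ofNat, at', hi]

/-- A subspace one step below which a new vector appears is obtained by adding that vector. -/
theorem at_sup_span (V : CompleteFlag F n) {i : ℕ} {v : Fin n → F} (h : v ∈ V.at' (i + 1))
    (h' : v ∉ V.at' i) : V.at' i ⊔ Submodule.span F {v} = V.at' (i + 1) := by
  refine Submodule.eq_of_le_of_finrank_le
    (sup_le (V.at_mono i.le_succ) (by simpa using h)) ?_
  rw [Submodule.finrank_sup_span_singleton h', finrank_at, finrank_at]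
  omega

theorem lt_of_notMem (V : CompleteFlag F n) {i : ℕ} {v : Fin n → F} (h : v ∉ V.at' i) :
    i < n := by
  by_contra hi
  exact h (by rw [V.at_of_le (by omega)]; trivial)

theorem exists_step (V : CompleteFlag F n) {v : Fin n → F} (hv : v ≠ 0) :
    ∃ i < n, v ∈ V.at' (i + 1) ∧ v ∉ V.at' i := by
  classical
  have hex : ∃ i, v ∈ V.at' i := ⟨n, by rw [V.at_of_le le_rfl]; trivial⟩
  obtain ⟨i, hi⟩ : ∃ i, Nat.find hex = i + 1 := by
    refine Nat.exists_eq_succ_of_ne_zero fun h0 => hv ?_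
    have := Nat.find_spec hex
    rw [h0, at_zero] at this
    simpa using this
  have h2 : v ∉ V.at' i := Nat.find_min hex (by omega)
  exact ⟨i, V.lt_of_notMem h2, hi ▸ Nat.find_spec hex, h2⟩

theorem step_unique (V : CompleteFlag F n) {v : Fin n → F} {i j : ℕ}
    (hi : v ∈ V.at' (i + 1)) (hi' : v ∉ V.at' i) (hj : v ∈ V.at' (j + 1)) (hj' : v ∉ V.at' j) :
    i = j := by
  rcases lt_trichotomy i j with h | h | h
  · exact absurd (V.at_mono h hi) hj'
  · exact h
  · exact absurd (V.at_mono h hj) hi'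

/-! ### Moving a line to the front of a flag -/

open Classical in
/-- The spaces of the flag obtained by moving the line of `v` to the front. -/
def insertSpace (V : CompleteFlag F n) (v : Fin n → F) : ℕ → Submodule F (Fin n → F)
  | 0 => ⊥
  | i + 1 => if v ∈ V.at' i then V.at' (i + 1) else V.at' i ⊔ Submodule.span F {v}

theorem insertSpace_succ_of_mem (V : CompleteFlag F n) {v : Fin n → F} {i : ℕ}
    (h : v ∈ V.at' i) : V.insertSpace v (i + 1) = V.at' (i + 1) := by
  simp [insertSpace, h]

theorem insertSpace_succ_of_notMem (V : CompleteFlag F n) {v : Fin n → F} {i : ℕ}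
    (h : v ∉ V.at' i) : V.insertSpace v (i + 1) = V.at' i ⊔ Submodule.span F {v} := by
  simp [insertSpace, h]

/-- If `v` first appears at index `i + 1`, both branches of the definition give the same space, so
membership there is enough. -/
theorem insertSpace_succ_of_step (V : CompleteFlag F n) {v : Fin n → F} {i : ℕ}
    (h : v ∈ V.at' (i + 1)) : V.insertSpace v (i + 1) = V.at' (i + 1) := by
  by_cases h' : v ∈ V.at' i
  · exact V.insertSpace_succ_of_mem h'
  · rw [V.insertSpace_succ_of_notMem h', V.at_sup_span h h']

theorem insertSpace_mono (V : CompleteFlag F n) (v : Fin n → F) :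
    Monotone (V.insertSpace v) := by
  refine monotone_nat_of_le_succ fun i => ?_
  rcases i with _ | i
  · exact bot_le
  by_cases h : v ∈ V.at' (i + 1)
  · rw [V.insertSpace_succ_of_step h, V.insertSpace_succ_of_mem h]
    exact V.at_mono (by omega)
  · rw [V.insertSpace_succ_of_notMem h,
      V.insertSpace_succ_of_notMem fun h' => h (V.at_mono i.le_succ h')]
    exact sup_le_sup_right (V.at_mono i.le_succ) _

theorem finrank_insertSpace (V : CompleteFlag F n) (v : Fin n → F) (i : ℕ) (hi : i ≤ n) :
    Module.finrank F (V.insertSpace v i) = i := by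
  rcases i with _ | i
  · exact finrank_bot F _
  by_cases h : v ∈ V.at' i
  · rw [V.insertSpace_succ_of_mem h, finrank_at]
    omega
  · rw [V.insertSpace_succ_of_notMem h, Submodule.finrank_sup_span_singleton h, finrank_at]
    omega

/-- The flag obtained from `V` by moving the line of `v` to the front. -/
def insertLine (V : CompleteFlag F n) (v : Fin n → F) : CompleteFlag F n :=
  ofNat (V.insertSpace v) (V.insertSpace_mono v) (V.finrank_insertSpace v)

theorem insertLine_at (V : CompleteFlag F n) (v : Fin n → F) (i : ℕ) :
    (V.insertLine v).at' i = V.insertSpace v i := by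
  rcases le_or_gt i n with h | h
  · exact at_ofNat _ _ _ i h
  · rw [at_of_le _ h.le]
    obtain ⟨j, rfl⟩ := Nat.exists_eq_succ_of_ne_zero (by omega : i ≠ 0)
    rw [Nat.succ_eq_add_one, insertSpace_succ_of_step] <;> rw [V.at_of_le h.le]
    trivial

/-- Apart from `0`, the spaces of `V.insertLine v` are the sums of those of `V` and the
line of `v`. -/
theorem forall_insertLine (V : CompleteFlag F n) {v : Fin n → F} (hv : v ≠ 0)
    {P : Submodule F (Fin n → F) → Prop} (h0 : P ⊥) :
    (∀ i, P ((V.insertLine v).at' i)) ↔ ∀ i, P (V.at' i ⊔ Submodule.span F {v}) := by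
  simp only [insertLine_at]
  constructor
  · intro h i
    -- If `V i` contains `v`, the sum is the inserted space of the same index; otherwise it is the
    -- one of the next index.
    by_cases hi : v ∈ V.at' i
    · obtain ⟨j, rfl⟩ : ∃ j, i = j + 1 := by
        refine Nat.exists_eq_succ_of_ne_zero ?_
        rintro rfl
        rw [at_zero] at hi
        exact hv (by simpa using hi)
      have := h (j + 1)
      rw [V.insertSpace_succ_of_step hi] at this
      rwa [sup_eq_left.mpr (by simpa using hi)]
    · have := h (i + 1)
      rwa [V.insertSpace_succ_of_notMem hi] at this
  · intro h i
    rcases i with _ | i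
    · exact h0
    by_cases hi : v ∈ V.at' i
    · rw [V.insertSpace_succ_of_mem hi]
      have := h (i + 1)
      rwa [sup_eq_left.mpr (by simpa using V.at_mono i.le_succ hi)] at this
    · rw [V.insertSpace_succ_of_notMem hi]
      exact h i

/-- The flag obtained from `V` by replacing the space of index `m + 1` with `V m + ⟨v⟩`. -/
theorem exists_replace (V : CompleteFlag F n) {v : Fin n → F} {m : ℕ} (hm : m + 1 < n)
    (h : v ∈ V.at' (m + 2)) (h' : v ∉ V.at' (m + 1)) :
    ∃ W : CompleteFlag F n, (∀ j, j ≠ m + 1 → W.at' j = V.at' j) ∧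
      W.at' (m + 1) = V.at' m ⊔ Submodule.span F {v} := by
  have h'' : v ∉ V.at' m := fun h => h' (V.at_mono m.le_succ h)
  let U : ℕ → Submodule F (Fin n → F) :=
    Function.update V.at' (m + 1) (V.at' m ⊔ Submodule.span F {v})
  have hU : ∀ j, j ≠ m + 1 → U j = V.at' j := fun j hj => Function.update_of_ne hj _ _
  have hU' : U (m + 1) = V.at' m ⊔ Submodule.span F {v} := Function.update_self _ _ _
  have hmono : Monotone U := by
    refine monotone_nat_of_le_succ fun i => ?_
    rcases eq_or_ne i (m + 1) with rfl | hi
    · rw [hU', hU _ (by omega)]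
      exact sup_le (V.at_mono (by omega)) (by simpa using h)
    · rw [hU _ hi]
      rcases eq_or_ne i m with rfl | hi'
      · rw [hU']
        exact le_sup_left
      · rw [hU _ (by omega)]
        exact V.at_mono i.le_succ
  have hr : ∀ i ≤ n, Module.finrank F (U i) = i := by
    intro i hin
    rcases eq_or_ne i (m + 1) with rfl | hi
    · rw [hU', Submodule.finrank_sup_span_singleton h'', finrank_at]
      omega
    · rw [hU _ hi, finrank_at]
      omega
  refine ⟨ofNat U hmono hr, fun j hj => ?_, ?_⟩
  · rcases le_or_gt j n with hjn | hjn
    · rw [at_ofNat _ _ _ _ hjn, hU _ hj]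
    · rw [at_of_le _ hjn.le, at_of_le _ hjn.le]
  · rw [at_ofNat _ _ _ _ (by omega), hU']

end CompleteFlag
end QTsetlin
end

noncomputable section

namespace QTsetlin

variable {F : Type*} [Field F] {n : ℕ}

/-! ### Normalized vectors -/

/-- The vector `v` has the form `e_i + ∑_{k > i} c_k e_k`. -/
def IsLead (v : Fin n → F) (i : Fin n) : Prop := v i = 1 ∧ ∀ j < i, v j = 0

theorem IsLead.ne_zero {v : Fin n → F} {i : Fin n} (h : IsLead v i) : v ≠ 0 := by
  rintro rfl
  exact zero_ne_one h.1

/-- Normalized vectors represent lines uniquely, which allows sums over lines to be written as sums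
over vectors. -/
theorem IsLead.eq_of_mem_span {u v : Fin n → F} {i j : Fin n} (hv : IsLead v i)
    (hu : IsLead u j) (h : u ∈ Submodule.span F {v}) : u = v := by
  obtain ⟨c, rfl⟩ := Submodule.mem_span_singleton.mp h
  have h1 : c * v j = 1 := hu.1
  have hc : c ≠ 0 := left_ne_zero_of_mul_eq_one h1
  have hij : i = j := by
    refine le_antisymm (not_lt.mp fun hlt => ?_) (not_lt.mp fun hlt => ?_)
    · rw [hv.2 j hlt, mul_zero] at h1
      exact zero_ne_one h1
    · have : c * v i = 0 := hu.2 i hlt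
      rw [hv.1, mul_one] at this
      exact hc this
  subst hij
  rw [hv.1, mul_one] at h1
  rw [h1, one_smul]

theorem IsLead.index_unique {v : Fin n → F} {i j : Fin n} (hi : IsLead v i)
    (hj : IsLead v j) : i = j := by
  rcases lt_trichotomy i j with h | h | h
  · exact absurd (hj.2 i h) (by rw [hi.1]; exact one_ne_zero)
  · exact h
  · exact absurd (hi.2 j h) (by rw [hj.1]; exact one_ne_zero)

theorem exists_isLead_smul {u : Fin n → F} (hu : u ≠ 0) :
    ∃ c : F, c ≠ 0 ∧ ∃ i, IsLead (c • u) i := by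
  classical
  obtain ⟨k, hk⟩ : ∃ k, u k ≠ 0 := by
    by_contra! h
    exact hu (funext h)
  obtain ⟨i, hi, hmin⟩ := WellFounded.has_min (wellFounded_lt (α := Fin n)) {k | u k ≠ 0}
    ⟨k, hk⟩
  refine ⟨(u i)⁻¹, inv_ne_zero hi, i, by simp [inv_mul_cancel₀ hi], fun j hj => ?_⟩
  have : u j = 0 := by
    by_contra h
    exact hmin j h hj
  simp [this]

theorem hasLead_iff (L : Submodule F (Fin n → F)) (i : Fin n) :
    HasLead L i ↔ ∃ v, IsLead v i ∧ L = Submodule.span F {v} := by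
  have key : ∀ (c : Fin n → F) (j : Fin n),
      (Pi.single i 1 + ∑ k ∈ Finset.Ioi i, c k • Pi.single k (1 : F) : Fin n → F) j =
        if j = i then 1 else if i < j then c j else 0 := by
    intro c j
    rw [Pi.add_apply, Finset.sum_apply]
    simp only [Pi.smul_apply, Pi.single_apply, smul_eq_mul, mul_ite, mul_one, mul_zero,
      Finset.sum_ite_eq, Finset.mem_Ioi]
    split_ifs with h1 h2
    · exact absurd h2 (by simp [h1])
    all_goals simp
  constructor
  · rintro ⟨c, rfl⟩
    refine ⟨_, ⟨?_, fun j hj => ?_⟩, rfl⟩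
    · rw [key, if_pos rfl]
    · rw [key, if_neg hj.ne, if_neg hj.not_gt]
  · rintro ⟨v, hv, rfl⟩
    refine ⟨v, ?_⟩
    congr 2
    funext j
    rw [key]
    split_ifs with h1 h2
    · rw [h1, hv.1]
    · rfl
    · exact hv.2 j (lt_of_le_of_ne (not_lt.mp h2) h1)

theorem IsLead.hasLead_span_iff {v : Fin n → F} {i : Fin n} (hv : IsLead v i) (j : Fin n) :
    HasLead (Submodule.span F {v}) j ↔ IsLead v j := by
  rw [hasLead_iff]
  refine ⟨?_, fun h => ⟨v, h, rfl⟩⟩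
  rintro ⟨u, hu, h⟩
  rwa [← hv.eq_of_mem_span hu (h ▸ Submodule.mem_span_singleton_self u)]

/-- The first space of a flag contains exactly one normalized vector. -/
theorem CompleteFlag.exists_isLead_at_one (V : CompleteFlag F n) (hn : 0 < n) :
    ∃ v, (∃ i, IsLead v i) ∧ V.at' 1 = Submodule.span F {v} := by
  have h1 : Module.finrank F (V.at' 1) = 1 := by
    rw [V.finrank_at]
    omega
  obtain ⟨u, hu, hu0⟩ := Submodule.exists_mem_ne_zero_of_ne_bot
    (p := V.at' 1) (by intro h; rw [h, finrank_bot] at h1; omega)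
  obtain ⟨c, hc, i, hi⟩ := exists_isLead_smul hu0
  exact ⟨c • u, ⟨i, hi⟩, eq_span_singleton_of_mem_of_finrank_eq_one h1
    (Submodule.smul_mem _ _ hu) hi.ne_zero⟩

variable [Fintype F] {K : Type*} [Field K]

/-! ### The chain moves a random line to the front -/

open Classical in
/-- The weight of a vector: `x_i / q ^ (n - i)` if it is normalized with leading term `e_i`, and
`0` if it is not normalized. -/
def vecWeight (x : Fin n → K) (v : Fin n → F) : K :=
  ∑ i : Fin n with IsLead v i, x i / (Fintype.card F : K) ^ (n - ((i : ℕ) + 1))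

theorem IsLead.vecWeight_eq {v : Fin n → F} {i : Fin n} (hv : IsLead v i) (x : Fin n → K) :
    vecWeight x v = x i / (Fintype.card F : K) ^ (n - ((i : ℕ) + 1)) := by
  classical
  rw [vecWeight, Finset.sum_eq_single_of_mem i (by simpa using hv)]
  intro j hj hji
  exact absurd (IsLead.index_unique (by simpa using hj) hv) hji

theorem vecWeight_eq_zero {v : Fin n → F} (hv : ¬ ∃ i, IsLead v i) (x : Fin n → K) :
    vecWeight x v = 0 := by
  classical
  rw [vecWeight, Finset.sum_eq_zero]
  intro j hj
  exact absurd ⟨j, by simpa using hj⟩ hv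

theorem IsLead.lineWeight_span {v : Fin n → F} {i : Fin n} (hv : IsLead v i)
    (x : Fin n → K) : lineWeight x (Submodule.span F {v}) = vecWeight x v := by
  classical
  rw [lineWeight, vecWeight]
  exact Finset.sum_congr (by ext j; simp [hv.hasLead_span_iff]) fun _ _ => rfl

theorem lineWeight_insertLine {v : Fin n → F} {i : Fin n} (hv : IsLead v i)
    (x : Fin n → K) (V : CompleteFlag F n) :
    lineWeight x ((V.insertLine v).V 1) = vecWeight x v := by
  have hn : 0 < n := i.pos
  have h1 : ((1 : Fin (n + 1)) : ℕ) = 1 := by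
    rw [Fin.val_one']
    exact Nat.mod_eq_of_lt (by omega)
  have h0 : v ∉ V.at' 0 := by
    rw [V.at_zero]
    simpa using hv.ne_zero
  rw [← CompleteFlag.at_coe, h1, CompleteFlag.insertLine_at,
    V.insertSpace_succ_of_notMem h0, V.at_zero, bot_sup_eq, hv.lineWeight_span]

theorem heckeT_single (i : ℕ) (hi : i < n) (V : CompleteFlag F n) [DecidablePred
    fun W : CompleteFlag F n => W ≠ V ∧ ∀ j, j ≠ i → W.at' j = V.at' j] :
    heckeT F n K i (Finsupp.single V 1) =
      ∑ W : CompleteFlag F n with W ≠ V ∧ ∀ j, j ≠ i → W.at' j = V.at' j,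
        Finsupp.single W 1 := by
  classical
  rw [heckeT, Finsupp.linearCombination_single, one_smul]
  refine Finset.sum_congr ?_ fun _ _ => rfl
  ext W
  simp only [Finset.mem_filter, Finset.mem_univ, true_and]
  refine and_congr_right fun _ => ⟨fun h j hj => ?_, fun h j hj => ?_⟩
  -- Indices above `n` are clamped to `n`, which still differs from `i` because `i < n`.
  · exact h _ (by simp only; omega)
  · rw [← CompleteFlag.at_coe, ← CompleteFlag.at_coe, h _ hj]

-- Induction on `m`. `T_{m+1}` replaces `V_{m+1}` by some `W_{m+1}`, and then `v` is taken in
-- `W_{m+1}` outside `V_m`. The vector determines `W_{m+1} = V_m + ⟨v⟩`, and `W ≠ V` means `v ∉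
-- V_{m+1}`; so the pairs `(W, v)` correspond to the `v` in `V_{m+2}` outside `V_{m+1}`.
open Classical in
theorem heckeProd_single (m : ℕ) (hm : m < n) (V : CompleteFlag F n) :
    heckeProd F n K m (Finsupp.single V 1) =
      ∑ v : Fin n → F with (∃ i, IsLead v i) ∧ v ∈ V.at' (m + 1) ∧ v ∉ V.at' m,
        Finsupp.single (V.insertLine v) 1 := by
  induction m generalizing V with
  | zero =>
    obtain ⟨v, ⟨i, hv⟩, hV⟩ := V.exists_isLead_at_one hm
    rw [Finset.sum_eq_single_of_mem v]
    · rw [heckeProd, LinearMap.id_apply]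
      congr 1
      refine CompleteFlag.ext_at fun j => ?_
      rw [CompleteFlag.insertLine_at]
      rcases j with _ | j
      · exact V.at_zero
      · rw [V.insertSpace_succ_of_step]
        refine V.at_mono (by omega : 1 ≤ j + 1) ?_
        rw [hV]
        exact Submodule.mem_span_singleton_self v
    · simp only [Finset.mem_filter, Finset.mem_univ, true_and, zero_add, hV, V.at_zero]
      exact ⟨⟨i, hv⟩, Submodule.mem_span_singleton_self v, by simpa using hv.ne_zero⟩
    · intro u hu huv
      simp only [Finset.mem_filter, Finset.mem_univ, true_and, zero_add, hV] at hu
      obtain ⟨⟨j, hj⟩, hu, -⟩ := hu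
      exact absurd (hv.eq_of_mem_span hj hu) huv
  | succ m ih =>
    rw [heckeProd, LinearMap.comp_apply, heckeT_single _ hm, map_sum,
      Finset.sum_congr rfl fun W _ => ih (by omega) W, Finset.sum_sigma']
    have aux : ∀ (W : CompleteFlag F n) (v : Fin n → F), W ≠ V →
        (∀ j, j ≠ m + 1 → W.at' j = V.at' j) → v ∈ W.at' (m + 1) → v ∉ W.at' m →
        W.at' (m + 1) = V.at' m ⊔ Submodule.span F {v} ∧ v ∈ V.at' (m + 2) ∧
          v ∉ V.at' (m + 1) := by
      intro W v hWV hW hv hv'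
      have h1 : W.at' (m + 1) = V.at' m ⊔ Submodule.span F {v} := by
        rw [← W.at_sup_span hv hv', hW m (by omega)]
      refine ⟨h1, ?_, fun h => hWV ?_⟩
      · rw [← hW _ (by omega)]
        exact W.at_mono (by omega) hv
      · refine CompleteFlag.ext_at fun j => ?_
        rcases eq_or_ne j (m + 1) with rfl | hj
        · rw [h1, V.at_sup_span h]
          rwa [← hW m (by omega)]
        · exact hW j hj
    refine Finset.sum_bij (fun p _ => p.2) ?_ ?_ ?_ ?_
    · rintro ⟨W, v⟩ h
      simp only [Finset.mem_sigma, Finset.mem_filter, Finset.mem_univ, true_and] at h ⊢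
      obtain ⟨⟨hWV, hW⟩, hl, hv, hv'⟩ := h
      exact ⟨hl, (aux W v hWV hW hv hv').2⟩
    · rintro ⟨W, v⟩ h ⟨W', v'⟩ h' e
      simp only [Finset.mem_sigma, Finset.mem_filter, Finset.mem_univ, true_and] at h h' e
      subst e
      have : W = W' := by
        refine CompleteFlag.ext_at fun j => ?_
        rcases eq_or_ne j (m + 1) with rfl | hj
        · rw [(aux W v h.1.1 h.1.2 h.2.2.1 h.2.2.2).1,
            (aux W' v h'.1.1 h'.1.2 h'.2.2.1 h'.2.2.2).1]
        · rw [h.1.2 j hj, h'.1.2 j hj]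
      rw [this]
    · intro v hv
      simp only [Finset.mem_filter, Finset.mem_univ, true_and] at hv
      obtain ⟨hl, hv, hv'⟩ := hv
      obtain ⟨W, hW, hW'⟩ := V.exists_replace hm hv hv'
      have hmem : v ∈ W.at' (m + 1) := by
        rw [hW']
        exact Submodule.mem_sup_right (Submodule.mem_span_singleton_self v)
      refine ⟨⟨W, v⟩, ?_, rfl⟩
      simp only [Finset.mem_sigma, Finset.mem_filter, Finset.mem_univ, true_and]
      refine ⟨⟨?_, hW⟩, hl, hmem, ?_⟩
      · rintro rfl
        exact hv' hmem
      · rw [hW m (by omega)]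
        exact fun h => hv' (V.at_mono m.le_succ h)
    · rintro ⟨W, v⟩ h
      simp only [Finset.mem_sigma, Finset.mem_filter, Finset.mem_univ, true_and] at h
      obtain ⟨⟨hWV, hW⟩, hl, hv, hv'⟩ := h
      obtain ⟨h1, h2, h3⟩ := aux W v hWV hW hv hv'
      congr 1
      refine CompleteFlag.ext_at fun j => ?_
      rw [CompleteFlag.insertLine_at, CompleteFlag.insertLine_at]
      rcases j with _ | j
      · rfl
      -- The inserted flag uses `W` only through spaces of index other than `m + 1`, where `W`
      -- agrees with `V`.
      rcases lt_trichotomy j (m + 1) with hj | rfl | hj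
      · have h4 : v ∉ W.at' j := fun h => hv' (W.at_mono (by omega) h)
        have h5 : v ∉ V.at' j := by rwa [← hW j (by omega)]
        rw [W.insertSpace_succ_of_notMem h4, V.insertSpace_succ_of_notMem h5,
          hW j (by omega)]
      · rw [W.insertSpace_succ_of_mem hv, V.insertSpace_succ_of_step h2, hW _ (by omega)]
      · rw [W.insertSpace_succ_of_mem (W.at_mono hj.le hv),
          V.insertSpace_succ_of_mem (V.at_mono (by omega : m + 2 ≤ j) h2), hW _ (by omega)]

/-- One step of the chain moves the line of a weighted normalized vector to the front. -/
theorem qTsetlin_single (x : Fin n → K) (V : CompleteFlag F n) :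
    qTsetlin F x (Finsupp.single V 1) =
      ∑ v : Fin n → F, Finsupp.single (V.insertLine v) (vecWeight x v) := by
  classical
  rw [qTsetlin, LinearMap.comp_apply, LinearMap.sum_apply,
    Finset.sum_congr rfl fun m hm => heckeProd_single m (Finset.mem_range.mp hm) V, map_sum,
    Finset.sum_congr rfl fun m _ => map_sum _ _ _]
  simp only [weightX, Finsupp.linearCombination_single, one_smul]
  simp only [Finset.sum_filter]
  rw [Finset.sum_comm]
  refine Finset.sum_congr rfl fun v _ => ?_
  by_cases hv : ∃ i, IsLead v i
  · obtain ⟨i, hi⟩ := hv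
    -- A nonzero vector enters the flag at exactly one step, so just one of the `n` products
    -- contributes it.
    obtain ⟨m, hm, h1, h2⟩ := V.exists_step hi.ne_zero
    rw [Finset.sum_eq_single_of_mem m (Finset.mem_range.mpr hm), if_pos ⟨⟨i, hi⟩, h1, h2⟩,
      lineWeight_insertLine hi]
    intro k _ hk
    rw [if_neg]
    rintro ⟨-, h3, h4⟩
    exact hk (V.step_unique h3 h4 h1 h2)
  · simp [hv, vecWeight_eq_zero]

end QTsetlin
end

noncomputable section

namespace QTsetlin

variable {F : Type*} [Field F] {n : ℕ}

/-! ### Stationary vectors -/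

namespace CompleteFlag

/-- Moving `k` successive generators of `W` to the front of `V` gives `W`: every sum
`W k + V j` is a space of `W`. -/
def Completes (W : CompleteFlag F n) (k : ℕ) (V : CompleteFlag F n) : Prop :=
  ∀ j, W.at' k ⊔ V.at' j ∈ Set.range W.at'

theorem at_eq_of_finrank (W : CompleteFlag F n) {U : Submodule F (Fin n → F)}
    (hU : U ∈ Set.range W.at') {k : ℕ} (hk : Module.finrank F U = min k n) : U = W.at' k := by
  obtain ⟨i, rfl⟩ := hU
  rw [finrank_at] at hk
  simp only [at', hk]

theorem completes_zero_iff (W V : CompleteFlag F n) : W.Completes 0 V ↔ V = W := by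
  simp only [Completes, at_zero, bot_sup_eq]
  refine ⟨fun h => ext_at fun j => W.at_eq_of_finrank (h j) (V.finrank_at j), ?_⟩
  rintro rfl j
  exact ⟨j, rfl⟩

theorem completes_of_le (W V : CompleteFlag F n) {k : ℕ} (hk : n ≤ k) : W.Completes k V :=
  fun _ => ⟨k, by rw [W.at_of_le hk, top_sup_eq]⟩

/-- Inserting `v` adds its line to every space of `V`; the only other space is `0`, whose sum with
`W k` is `W k` itself. -/
theorem completes_insertLine_iff (W V : CompleteFlag F n) (k : ℕ) {v : Fin n → F}
    (hv : v ≠ 0) : W.Completes k (V.insertLine v) ↔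
      ∀ j, W.at' k ⊔ Submodule.span F {v} ⊔ V.at' j ∈ Set.range W.at' := by
  have := V.forall_insertLine hv (P := fun U => W.at' k ⊔ U ∈ Set.range W.at')
    ⟨k, by rw [sup_bot_eq]⟩
  rw [Completes, this]
  refine forall_congr' fun j => ?_
  rw [sup_assoc, sup_comm (V.at' j)]

theorem completes_insertLine_of_mem (W V : CompleteFlag F n) {k : ℕ} {v : Fin n → F}
    (hv : v ≠ 0) (h : v ∈ W.at' k) : W.Completes k (V.insertLine v) ↔ W.Completes k V := by
  rw [completes_insertLine_iff W V k hv, sup_eq_left.mpr (by simpa using h), Completes]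

theorem completes_insertLine_of_step (W V : CompleteFlag F n) {k : ℕ} {v : Fin n → F}
    (hv : v ≠ 0) (h : v ∉ W.at' k) (h' : v ∈ W.at' (k + 1)) :
    W.Completes k (V.insertLine v) ↔ W.Completes (k + 1) V := by
  rw [completes_insertLine_iff W V k hv, W.at_sup_span h' h, Completes]

/-- The sum `W k + ⟨v⟩` has dimension `k + 1`, so as a space of `W` it would be `W (k + 1)`, which
omits `v`. -/
theorem not_completes_insertLine (W V : CompleteFlag F n) {k : ℕ} {v : Fin n → F}
    (hv : v ≠ 0) (h : v ∉ W.at' (k + 1)) : ¬ W.Completes k (V.insertLine v) := by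
  rw [completes_insertLine_iff W V k hv]
  intro hc
  have h1 := hc 0
  rw [at_zero, sup_bot_eq] at h1
  have h2 : v ∉ W.at' k := fun h' => h (W.at_mono k.le_succ h')
  refine h (W.at_eq_of_finrank h1 (k := k + 1) ?_ ▸
    Submodule.mem_sup_right (Submodule.mem_span_singleton_self v))
  have := W.lt_of_notMem h
  rw [Submodule.finrank_sup_span_singleton h2, finrank_at]
  omega

end CompleteFlag

variable [Fintype F] {K : Type*} [Field K]

/-! ### The recursion for stationary vectors -/

open Classical in
/-- The total weight of the lines of a subspace. -/
def spaceWeight (x : Fin n → K) (U : Submodule F (Fin n → F)) : K :=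
  ∑ v : Fin n → F with v ∈ U, vecWeight x v

/-- This is the transpose of the chain acting on test functions `c`. It is applied to the indicator
of `Completes` and to the constant `1`. -/
theorem sum_mul_qTsetlin (x : Fin n → K) (c : CompleteFlag F n → K)
    (Φ : CompleteFlag F n →₀ K) :
    ∑ W, c W * qTsetlin F x Φ W =
      ∑ V, Φ V * ∑ v : Fin n → F, vecWeight x v * c (V.insertLine v) := by
  classical
  induction Φ using Finsupp.induction_linear with
  | zero => simp
  | add f g hf hg =>
    simp only [map_add, Finsupp.add_apply, mul_add, add_mul, Finset.sum_add_distrib, hf, hg]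
  | single V a =>
    rw [← mul_one a, ← smul_eq_mul, ← Finsupp.smul_single, map_smul, qTsetlin_single]
    simp only [Finsupp.smul_apply, Finsupp.finsetSum_apply, Finsupp.single_apply,
      smul_eq_mul, Finset.mul_sum, mul_ite, ite_mul, mul_one, mul_zero, zero_mul]
    rw [Finset.sum_comm]
    simp only [Finset.sum_ite_eq, Finset.mem_univ, if_true]
    rw [Finset.sum_comm]
    simp only [Finset.sum_ite_eq, Finset.mem_univ, if_true]
    exact Finset.sum_congr rfl fun v _ => by ring

-- A line inside `W k` changes nothing, a line new in `W (k + 1)` advances `k` by one, and any other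
-- line makes completion impossible.
open Classical in
theorem sum_vecWeight_completes (x : Fin n → K) (W V : CompleteFlag F n) (k : ℕ) :
    ∑ v : Fin n → F, vecWeight x v * (if W.Completes k (V.insertLine v) then 1 else 0) =
      spaceWeight x (W.at' k) * (if W.Completes k V then 1 else 0) +
        (spaceWeight x (W.at' (k + 1)) - spaceWeight x (W.at' k)) *
          (if W.Completes (k + 1) V then 1 else 0) := by
  simp only [spaceWeight, Finset.sum_filter, ← Finset.sum_sub_distrib, Finset.sum_mul,
    ← Finset.sum_add_distrib]
  refine Finset.sum_congr rfl fun v _ => ?_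
  by_cases hl : ∃ i, IsLead v i
  · obtain ⟨i, hi⟩ := hl
    by_cases h1 : v ∈ W.at' k
    · simp [h1, W.at_mono k.le_succ h1, W.completes_insertLine_of_mem V hi.ne_zero h1]
    by_cases h2 : v ∈ W.at' (k + 1)
    · simp [h1, h2, W.completes_insertLine_of_step V hi.ne_zero h1 h2]
    · simp [h1, h2, W.not_completes_insertLine V hi.ne_zero h2]
  · simp [vecWeight_eq_zero hl]

open Classical in
theorem IsStationary.step {x : Fin n → K} {Φ : CompleteFlag F n →₀ K}
    (h : IsStationary F x Φ) (W : CompleteFlag F n) (k : ℕ) :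
    (∑ i, x i - spaceWeight x (W.at' k)) *
        ∑ V, Φ V * (if W.Completes k V then 1 else 0) =
      (spaceWeight x (W.at' (k + 1)) - spaceWeight x (W.at' k)) *
        ∑ V, Φ V * (if W.Completes (k + 1) V then 1 else 0) := by
  have key := sum_mul_qTsetlin x (fun V => if W.Completes k V then 1 else 0) Φ
  rw [show qTsetlin F x Φ = _ from h] at key
  simp only [sum_vecWeight_completes, Finsupp.smul_apply, smul_eq_mul, mul_add,
    Finset.sum_add_distrib] at key
  have h1 : ∑ V, (if W.Completes k V then 1 else 0) * ((∑ i, x i) * Φ V) =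
      (∑ i, x i) * ∑ V, Φ V * (if W.Completes k V then 1 else 0) := by
    rw [Finset.mul_sum]
    exact Finset.sum_congr rfl fun V _ => by ring
  have h2 : ∀ (a : K) (p : CompleteFlag F n → K), ∑ V, Φ V * (a * p V) =
      a * ∑ V, Φ V * p V := by
    intro a p
    rw [Finset.mul_sum]
    exact Finset.sum_congr rfl fun V _ => by ring
  rw [h1, h2, h2] at key
  rw [sub_mul, key]
  ring

/-- A stationary vector is determined by the sum of its entries. -/
theorem IsStationary.apply_eq {x : Fin n → K}
    (hx : ∀ U : Submodule F (Fin n → F), U ≠ ⊤ → ∑ i, x i - spaceWeight x U ≠ 0)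
    {Φ : CompleteFlag F n →₀ K} (h : IsStationary F x Φ) (W : CompleteFlag F n) :
    Φ W = (∑ V, Φ V) * ∏ k ∈ Finset.range n,
      ((spaceWeight x (W.at' (k + 1)) - spaceWeight x (W.at' k)) /
        (∑ i, x i - spaceWeight x (W.at' k))) := by
  classical
  -- The recursion is unrolled from `m = 0`, where only `W` is counted, to `m = n`, where every flag
  -- is.
  have key : ∀ m ≤ n, Φ W = (∑ V, Φ V * (if W.Completes m V then 1 else 0)) *
      ∏ k ∈ Finset.range m, ((spaceWeight x (W.at' (k + 1)) - spaceWeight x (W.at' k)) /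
        (∑ i, x i - spaceWeight x (W.at' k))) := by
    intro m
    induction m with
    | zero => simp [CompleteFlag.completes_zero_iff]
    | succ m ih =>
      intro hm
      have hne := hx _ (W.at_ne_top hm)
      rw [ih (by omega), Finset.prod_range_succ, mul_comm (∏ k ∈ _, _), ← mul_assoc]
      congr 1
      rw [← mul_div_assoc, eq_div_iff hne, mul_comm, h.step W m, mul_comm]
  rw [key n le_rfl]
  simp [CompleteFlag.completes_of_le]

/-- The chain has a stationary vector, unique up to scaling. -/
theorem exists_isStationary [Nonempty (CompleteFlag F n)] {x : Fin n → K}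
    (htop : spaceWeight x (⊤ : Submodule F (Fin n → F)) = ∑ i, x i)
    (hx : ∀ U : Submodule F (Fin n → F), U ≠ ⊤ → ∑ i, x i - spaceWeight x U ≠ 0) :
    ∃ Φ : CompleteFlag F n →₀ K, IsStationary F x Φ ∧ ∑ V, Φ V = 1 := by
  classical
  have hsum : ∀ Φ : CompleteFlag F n →₀ K,
      ∑ V, qTsetlin F x Φ V = (∑ i, x i) * ∑ V, Φ V := by
    intro Φ
    have := sum_mul_qTsetlin x (fun _ => 1) Φ
    simp only [one_mul, mul_one] at this
    rw [this, ← Finset.sum_mul, mul_comm, ← htop, spaceWeight]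
    simp
  let A : (CompleteFlag F n →₀ K) →ₗ[K] (CompleteFlag F n →₀ K) :=
    qTsetlin F x - (∑ i, x i) • LinearMap.id
  -- Every vector in the image of `A` has total `0`. In finite dimension, failure of surjectivity
  -- yields a nonzero kernel vector.
  have hA : ¬ Function.Surjective A := by
    intro hs
    obtain ⟨V₀⟩ := ‹Nonempty (CompleteFlag F n)›
    obtain ⟨Φ, hΦ⟩ := hs (Finsupp.single V₀ 1)
    have h0 : ∑ V, A Φ V = 0 := by
      simp [A, Finset.sum_sub_distrib, hsum, ← Finset.mul_sum]
    rw [hΦ] at h0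
    simp [Finsupp.single_apply] at h0
  rw [← LinearMap.injective_iff_surjective, ← LinearMap.ker_eq_bot,
    Submodule.eq_bot_iff] at hA
  push Not at hA
  obtain ⟨Φ, hΦ, hΦ0⟩ := hA
  have hst : IsStationary F x Φ := by
    have : qTsetlin F x Φ - (∑ i, x i) • Φ = 0 := hΦ
    exact sub_eq_zero.mp this
  -- By the product formula, a stationary vector of total `0` vanishes.
  have hs : ∑ V, Φ V ≠ 0 := by
    intro hs
    refine hΦ0 (Finsupp.ext fun W => ?_)
    rw [hst.apply_eq hx W, hs, zero_mul, Finsupp.zero_apply]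
  refine ⟨(∑ V, Φ V)⁻¹ • Φ, ?_, ?_⟩
  · rw [IsStationary, map_smul, show qTsetlin F x Φ = _ from hst, smul_comm]
  · simp [← Finset.mul_sum, hs]

end QTsetlin
end

noncomputable section

namespace QTsetlin

variable {F : Type*} [Field F] {n : ℕ}

/-! ### Spaces of the flag of a matrix -/

theorem flagOf_at (g : GL (Fin n) F) (k : ℕ) :
    (flagOf g).at' k = Submodule.span F (g.1.col '' {j : Fin n | (j : ℕ) < k}) := by
  have : {j : Fin n | (j : ℕ) < min k n} = {j : Fin n | (j : ℕ) < k} := by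
    ext j
    simp
  simp only [CompleteFlag.at', flagOf, this]

theorem flagOf_mul_at (a g : GL (Fin n) F) (k : ℕ) :
    (flagOf (a * g)).at' k = ((flagOf g).at' k).map a.1.mulVecLin := by
  rw [flagOf_at, flagOf_at, Submodule.map_span, Set.image_image]
  congr 1

/-- Each column of `g * b` combines columns of `g` of no larger index; equal dimensions turn the
inclusion into equality. -/
theorem flagOf_mul_upper (g : GL (Fin n) F) {b : GL (Fin n) F} (hb : b ∈ upperB F n) :
    flagOf (g * b) = flagOf g := by
  refine CompleteFlag.ext_at fun k => ?_
  refine Submodule.eq_of_le_of_finrank_eq ?_ (by simp only [CompleteFlag.finrank_at])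
  rw [flagOf_at, flagOf_at, Submodule.span_le]
  rintro _ ⟨j, hj, rfl⟩
  have : (g * b).1.col j = ∑ i, b.1 i j • g.1.col i := by
    funext l
    simp [Matrix.mul_apply, mul_comm]
  rw [this]
  refine Submodule.sum_mem _ fun i _ => ?_
  by_cases hij : j < i
  · rw [hb i j hij, zero_smul]
    exact Submodule.zero_mem _
  · refine Submodule.smul_mem _ _ (Submodule.subset_span ⟨i, ?_, rfl⟩)
    exact lt_of_le_of_lt (Fin.le_def.mp (not_lt.mp hij)) (show (j : ℕ) < k from hj)

/-- The span of the basis vectors with index in `T`. -/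
def coordSpace (F : Type*) [Field F] (T : Finset (Fin n)) : Submodule F (Fin n → F) :=
  Submodule.pi (T : Set (Fin n))ᶜ fun _ => ⊥

theorem mem_coordSpace {T : Finset (Fin n)} {v : Fin n → F} :
    v ∈ coordSpace F T ↔ ∀ t, t ∉ T → v t = 0 := by
  simp [coordSpace, Submodule.mem_pi]

theorem coordSpace_univ : coordSpace F (Finset.univ : Finset (Fin n)) = ⊤ := by
  ext v
  simp [mem_coordSpace]

theorem permFlag_at (π : Equiv.Perm (Fin n)) (k : ℕ) :
    (permFlag F π).at' k =
      coordSpace F ((Finset.univ.filter fun j : Fin n => (j : ℕ) < k).image π) := by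
  have hcol : ∀ j, (permGL F π).1.col j = Pi.single (π j) 1 := by
    intro j
    funext i
    rw [Matrix.col_apply, permGL_apply, Pi.single_apply]
  rw [permFlag, flagOf_at]
  refine le_antisymm (Submodule.span_le.mpr ?_) fun v hv => ?_
  · rintro _ ⟨j, hj, rfl⟩
    rw [hcol, SetLike.mem_coe, mem_coordSpace]
    intro t ht
    refine Pi.single_eq_of_ne ?_ 1
    rintro rfl
    exact ht (Finset.mem_image_of_mem _ (by simpa using hj))
  · rw [mem_coordSpace] at hv
    rw [← Finset.univ_sum_single v]
    refine Submodule.sum_mem _ fun t _ => ?_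
    by_cases ht : t ∈ (Finset.univ.filter fun j : Fin n => (j : ℕ) < k).image π
    · obtain ⟨j, hj, rfl⟩ := Finset.mem_image.mp ht
      have : (Pi.single (π j) (v (π j)) : Fin n → F) =
          v (π j) • (permGL F π).1.col j := by
        rw [hcol, ← Pi.single_smul, smul_eq_mul, mul_one]
      rw [this]
      exact Submodule.smul_mem _ _ (Submodule.subset_span ⟨j, by simpa using hj, rfl⟩)
    · rw [hv t ht, Pi.single_zero]
      exact Submodule.zero_mem _

theorem permFlag_at_coe (π : Equiv.Perm (Fin n)) (k : Fin n) :
    (permFlag F π).at' k = coordSpace F ((Finset.Iio k).image π) := by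
  rw [permFlag_at]
  congr 2
  ext j
  simp

theorem permFlag_at_succ (π : Equiv.Perm (Fin n)) (k : Fin n) :
    (permFlag F π).at' (k + 1) = coordSpace F ((Finset.Iic k).image π) := by
  have : (Finset.univ.filter fun j : Fin n => (j : ℕ) < k + 1) = Finset.Iic k := by
    ext j
    rw [Finset.mem_filter, Finset.mem_Iic, Fin.le_def, Nat.lt_succ_iff]
    exact and_iff_right (Finset.mem_univ j)
  rw [permFlag_at, this]

/-! ### Lower triangular matrices -/

theorem lower_diag_ne_zero {b : GL (Fin n) F} (hb : b ∈ lowerB F n) (i : Fin n) :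
    b.1 i i ≠ 0 := by
  have hdet : b.1.det = ∏ i, b.1 i i := Matrix.det_of_isLowerTriangular b.1 fun i j h => hb i j h
  have hu : b.1.det ≠ 0 := ((Matrix.isUnit_iff_isUnit_det b.1).mp b.isUnit).ne_zero
  rw [hdet] at hu
  exact Finset.prod_ne_zero_iff.mp hu i (Finset.mem_univ i)

theorem lower_mulVec_apply {b : GL (Fin n) F} (hb : b ∈ lowerB F n) {v : Fin n → F}
    {i : Fin n} (hv : ∀ j < i, v j = 0) : b.1.mulVec v i = b.1 i i * v i := by
  rw [Matrix.mulVec, dotProduct, Finset.sum_eq_single_of_mem i (Finset.mem_univ i)]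
  intro j _ hj
  rcases lt_or_gt_of_ne hj with h | h
  · rw [hv j h, mul_zero]
  · rw [hb i j h, zero_mul]

/-- The first nonzero coordinate keeps its position and is only scaled by a nonzero diagonal entry.
-/
theorem lower_mulVec_eq_zero {b : GL (Fin n) F} (hb : b ∈ lowerB F n) {v : Fin n → F}
    {i : Fin n} : (∀ j < i, b.1.mulVec v j = 0) ↔ ∀ j < i, v j = 0 := by
  constructor
  · intro h j
    induction j using WellFoundedLT.induction with
    | ind j ih =>
      intro hj
      have h1 := h j hj
      rw [lower_mulVec_apply hb fun l hl => ih l hl (hl.trans hj)] at h1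
      exact (mul_eq_zero.mp h1).resolve_left (lower_diag_ne_zero hb j)
  · intro h j hj
    rw [lower_mulVec_apply hb fun l hl => h l (hl.trans hj), h j hj, mul_zero]

/-! ### Counting normalized vectors -/

variable [Fintype F] {K : Type*} [Field K]

open Classical in
/-- The number of normalized vectors of `U` with leading term `e_i`. -/
def leadCount (U : Submodule F (Fin n → F)) (i : Fin n) : ℕ :=
  (Finset.univ.filter fun v : Fin n → F => v ∈ U ∧ IsLead v i).card

theorem spaceWeight_eq_sum (x : Fin n → K) (U : Submodule F (Fin n → F)) :
    spaceWeight x U =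
      ∑ i, x i / (Fintype.card F : K) ^ (n - ((i : ℕ) + 1)) * (leadCount U i : K) := by
  classical
  simp only [spaceWeight, vecWeight, Finset.sum_filter (p := fun i => IsLead _ i)]
  rw [Finset.sum_comm]
  refine Finset.sum_congr rfl fun i _ => ?_
  rw [← Finset.sum_filter, Finset.sum_const, Finset.filter_filter, leadCount, nsmul_eq_mul,
    mul_comm]

/-- The coordinate at `s` is `1`, those at `t ∈ T` with `t > s` are free, and all others vanish. -/
theorem leadCount_coordSpace (T : Finset (Fin n)) (s : Fin n) :
    leadCount (coordSpace F T) s =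
      if s ∈ T then Fintype.card F ^ (T.filter fun t => s < t).card else 0 := by
  classical
  split_ifs with hs
  · have : (Finset.univ.filter fun v : Fin n → F => v ∈ coordSpace F T ∧ IsLead v s) =
        Fintype.piFinset fun t =>
          if t = s then {1} else if t ∈ T ∧ s < t then Finset.univ else {0} := by
      ext v
      simp only [Finset.mem_filter, Finset.mem_univ, true_and, mem_coordSpace, IsLead,
        Fintype.mem_piFinset]
      constructor
      · rintro ⟨h1, h2, h3⟩ t
        split_ifs with h4 h5
        · simp [h4, h2]
        · simp
        · rw [Finset.mem_singleton]
          by_cases h6 : t ∈ T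
          · exact h3 t (lt_of_le_of_ne (not_lt.mp fun h => h5 ⟨h6, h⟩) h4)
          · exact h1 t h6
      · intro h
        refine ⟨fun t ht => ?_, by simpa using h s, fun t ht => ?_⟩
        · have h1 := h t
          rw [if_neg (by rintro rfl; exact ht hs), if_neg fun h => ht h.1] at h1
          simpa using h1
        · have h1 := h t
          rw [if_neg ht.ne, if_neg fun h => lt_asymm ht h.2] at h1
          simpa using h1
    rw [leadCount, this, Fintype.card_piFinset, Finset.card_filter, ← Finset.prod_pow_eq_pow_sum,
      ← Finset.prod_subset (Finset.subset_univ T)]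
    · refine Finset.prod_congr rfl fun t ht => ?_
      by_cases h1 : t = s
      · simp [h1]
      · by_cases h2 : s < t <;> simp [h1, h2, ht]
    · intro t _ ht
      by_cases h1 : t = s <;> simp [h1, ht]
  · rw [leadCount, Finset.card_eq_zero, Finset.filter_eq_empty_iff]
    rintro v - ⟨h1, h2, -⟩
    rw [mem_coordSpace.mp h1 s hs] at h2
    exact zero_ne_one h2

theorem leadCount_top (i : Fin n) :
    leadCount (⊤ : Submodule F (Fin n → F)) i = Fintype.card F ^ (n - ((i : ℕ) + 1)) := by
  rw [← coordSpace_univ, leadCount_coordSpace, if_pos (Finset.mem_univ i)]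
  congr 1
  rw [show (Finset.univ.filter fun t => i < t) = Finset.Ioi i by ext; simp, Fin.card_Ioi]
  omega

theorem leadCount_mono {U U' : Submodule F (Fin n → F)} (h : U ≤ U') (i : Fin n) :
    leadCount U i ≤ leadCount U' i := by
  classical
  exact Finset.card_le_card fun v hv => by
    simp only [Finset.mem_filter, Finset.mem_univ, true_and] at hv ⊢
    exact ⟨h hv.1, hv.2⟩

theorem exists_leadCount_lt {U : Submodule F (Fin n → F)} (hU : U ≠ ⊤) :
    ∃ i, leadCount U i < leadCount (⊤ : Submodule F (Fin n → F)) i := by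
  classical
  obtain ⟨v, -, hv⟩ := SetLike.exists_of_lt (lt_top_iff_ne_top.mpr hU)
  obtain ⟨c, hc, i, hi⟩ := exists_isLead_smul (u := v) (by rintro rfl; exact hv U.zero_mem)
  have hcv : c • v ∉ U := fun h => hv ((U.smul_mem_iff hc).mp h)
  refine ⟨i, Finset.card_lt_card ((Finset.ssubset_iff_of_subset fun u hu => ?_).mpr
    ⟨c • v, by simpa using hi, by simp [hcv]⟩)⟩
  simp only [Finset.mem_filter, Finset.mem_univ, true_and] at hu ⊢
  exact ⟨trivial, hu.2⟩

theorem leadCount_map_lower {b : GL (Fin n) F} (hb : b ∈ lowerB F n)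
    (U : Submodule F (Fin n → F)) (i : Fin n) :
    leadCount (U.map b.1.mulVecLin) i = leadCount U i := by
  classical
  have hd := lower_diag_ne_zero hb i
  symm
  -- Dividing by the diagonal entry makes the image of a normalized vector normalized again.
  refine Finset.card_bij (fun v _ => b.1.mulVec ((b.1 i i)⁻¹ • v)) ?_ ?_ ?_
  · intro v hv
    simp only [Finset.mem_filter, Finset.mem_univ, true_and] at hv ⊢
    obtain ⟨hU, h1, h0⟩ := hv
    have h0' : ∀ j < i, ((b.1 i i)⁻¹ • v) j = 0 := fun j hj => by simp [h0 j hj]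
    refine ⟨⟨_, U.smul_mem _ hU, rfl⟩, ?_, (lower_mulVec_eq_zero hb).mpr h0'⟩
    rw [lower_mulVec_apply hb h0', Pi.smul_apply, h1, smul_eq_mul, mul_one,
      mul_inv_cancel₀ hd]
  · intro v _ v' _ h
    exact smul_right_injective _ (inv_ne_zero hd)
      (Matrix.mulVec_injective_of_isUnit b.isUnit h)
  · intro u hu
    simp only [Finset.mem_filter, Finset.mem_univ, true_and] at hu
    obtain ⟨⟨v, hv, rfl⟩, h1, h0⟩ := hu
    simp only [Matrix.mulVecLin_apply] at h1 h0
    have h0' := (lower_mulVec_eq_zero hb).mp h0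
    rw [lower_mulVec_apply hb h0'] at h1
    refine ⟨b.1 i i • v, ?_, ?_⟩
    · simp only [Finset.mem_filter, Finset.mem_univ, true_and]
      exact ⟨U.smul_mem _ hv, by simpa using h1, fun j hj => by simp [h0' j hj]⟩
    · rw [smul_smul, inv_mul_cancel₀ hd, one_smul, Matrix.mulVecLin_apply]

theorem spaceWeight_at_of_mem_cell (x : Fin n → K) {π : Equiv.Perm (Fin n)}
    {V : CompleteFlag F n} (hV : V ∈ cell F π) (k : ℕ) :
    spaceWeight x (V.at' k) = spaceWeight x ((permFlag F π).at' k) := by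
  obtain ⟨g, hg, rfl⟩ := hV
  obtain ⟨a, ha, b, hb, rfl⟩ := DoubleCoset.mem_doubleCoset.mp hg
  rw [flagOf_mul_upper _ hb, flagOf_mul_at, spaceWeight_eq_sum, spaceWeight_eq_sum]
  simp only [leadCount_map_lower ha, permFlag]

/-! ### The weights of coordinate subspaces -/

theorem spaceWeight_coordSpace (x : Fin n → K) (T : Finset (Fin n)) :
    spaceWeight x (coordSpace F T) =
      ∑ s ∈ T, x s / (Fintype.card F : K) ^ (n - ((s : ℕ) + 1)) *
        (Fintype.card F : K) ^ (T.filter fun t => s < t).card := by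
  rw [spaceWeight_eq_sum, ← Finset.sum_subset (Finset.subset_univ T)]
  · refine Finset.sum_congr rfl fun s hs => ?_
    rw [leadCount_coordSpace, if_pos hs, Nat.cast_pow]
  · intro s _ hs
    rw [leadCount_coordSpace, if_neg hs, Nat.cast_zero, mul_zero]

theorem spaceWeight_bot (x : Fin n → K) :
    spaceWeight x (⊥ : Submodule F (Fin n → F)) = 0 := by
  refine Finset.sum_eq_zero fun v hv => vecWeight_eq_zero ?_ x
  rintro ⟨i, hi⟩
  exact hi.ne_zero (by simpa using hv)

variable [CharZero K]

variable (F K) in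
theorem card_cast_ne_zero : (Fintype.card F : K) ≠ 0 :=
  Nat.cast_ne_zero.mpr Fintype.card_ne_zero

theorem spaceWeight_top (x : Fin n → K) :
    spaceWeight x (⊤ : Submodule F (Fin n → F)) = ∑ i, x i := by
  rw [spaceWeight_eq_sum]
  refine Finset.sum_congr rfl fun i _ => ?_
  rw [leadCount_top, Nat.cast_pow,
    div_mul_cancel₀ _ (pow_ne_zero _ (card_cast_ne_zero F K))]

/-- The coefficient of `x i` is the proportion of normalized vectors with leading term `e_i` outside
`U`. Both positivity and nonvanishing of the denominators rest on this form. -/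
theorem sum_sub_spaceWeight (x : Fin n → K) (U : Submodule F (Fin n → F)) :
    ∑ i, x i - spaceWeight x U =
      ∑ i, x i * (1 - leadCount U i / leadCount (⊤ : Submodule F (Fin n → F)) i) := by
  rw [spaceWeight_eq_sum, ← Finset.sum_sub_distrib]
  refine Finset.sum_congr rfl fun i _ => ?_
  rw [leadCount_top, Nat.cast_pow]
  ring

theorem scaledRate_eq (x : Fin n → K) (π : Equiv.Perm (Fin n)) (k s : Fin n) :
    scaledRate F x π k s = x s / (Fintype.card F : K) ^ (n - ((s : ℕ) + 1)) *
      (Fintype.card F : K) ^ bStat π k s := by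
  have h : (n : ℤ) - ((s : ℤ) + 1) = ((n - ((s : ℕ) + 1) : ℕ) : ℤ) := by omega
  rw [scaledRate, zpow_sub₀ (card_cast_ne_zero F K), h, zpow_natCast, zpow_natCast,
    div_div_eq_mul_div, mul_div_right_comm]

theorem denFactor_eq (x : Fin n → K) (π : Equiv.Perm (Fin n)) (k : Fin n) :
    denFactor F x π k = ∑ i, x i - spaceWeight x ((permFlag F π).at' k) := by
  rw [denFactor, permFlag_at_coe, spaceWeight_coordSpace]
  simp only [scaledRate_eq, bStat]

/-- Adjoining `π k` contributes its own rate. It also raises `b(s)` by one for each earlier `s < π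
k`, so that term grows by `q - 1` times itself; terms with `s > π k` do not change. -/
theorem numFactor_eq (x : Fin n → K) (π : Equiv.Perm (Fin n)) (k : Fin n) :
    numFactor F x π k = (spaceWeight x ((permFlag F π).at' (k + 1)) -
      spaceWeight x ((permFlag F π).at' k)) / ∑ i, x i := by
  have hIic : (Finset.Iic k).image π = insert (π k) ((Finset.Iio k).image π) := by
    rw [← Finset.Iio_insert, Finset.image_insert]
  have hk : π k ∉ (Finset.Iio k).image π := by simp
  rw [permFlag_at_coe, permFlag_at_succ, spaceWeight_coordSpace, spaceWeight_coordSpace,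
    numFactor, hIic, Finset.sum_filter, Finset.sum_insert hk, Finset.sum_insert hk,
    add_sub_assoc, ← Finset.sum_sub_distrib, add_div, Finset.sum_div]
  congr 1
  · rw [if_pos le_rfl, if_neg (lt_irrefl _), pow_zero, mul_one, scaledRate_eq, bStat,
      Finset.filter_insert, if_neg (lt_irrefl _)]
  · refine Finset.sum_congr rfl fun s hs => ?_
    have hne : s ≠ π k := by
      rintro rfl
      exact hk hs
    rw [Finset.filter_insert]
    by_cases h : s < π k
    · rw [if_pos h.le, if_pos h, if_pos h, Finset.card_insert_of_notMem (by simp),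
        scaledRate_eq, bStat]
      ring
    · rw [if_neg fun h' => h (lt_of_le_of_ne h' hne), if_neg h, sub_self, zero_div]

/-! ### The stationary vector -/

theorem exists_stationary_formula {x : Fin n → K}
    (hx : ∀ U : Submodule F (Fin n → F), U ≠ ⊤ → ∑ i, x i - spaceWeight x U ≠ 0) :
    (∀ (π : Equiv.Perm (Fin n)) (k : Fin n), denFactor F x π k ≠ 0) ∧
    ∃ Ψ : CompleteFlag F n →₀ K, IsStationary F x Ψ ∧
      (∀ W, Ψ W = ∏ k ∈ Finset.range n,
        ((spaceWeight x (W.at' (k + 1)) - spaceWeight x (W.at' k)) / (∑ i, x i) /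
          (∑ i, x i - spaceWeight x (W.at' k)))) ∧
      (∀ Φ : CompleteFlag F n →₀ K, IsStationary F x Φ →
        Φ = ((∑ V, Φ V) * (∑ i, x i) ^ n) • Ψ) ∧
      (∑ i, x i = 1 → ∑ V, Ψ V = 1) ∧
      (∀ π : Equiv.Perm (Fin n), ∀ V ∈ cell F π, ∀ V' ∈ cell F π, Ψ V = Ψ V') ∧
      (∀ π : Equiv.Perm (Fin n),
        Ψ (permFlag F π) = ∏ k : Fin n, numFactor F x π k / denFactor F x π k) := by
  have : Nonempty (CompleteFlag F n) := ⟨permFlag F 1⟩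
  -- For `n = 0` the sum is `0` but its power is `1`; otherwise the sum is the denominator of the
  -- zero subspace.
  have hX : (∑ i, x i) ^ n ≠ 0 := by
    rcases n.eq_zero_or_pos with rfl | hn
    · simp
    · have hbot : (⊥ : Submodule F (Fin n → F)) ≠ ⊤ := by
        rw [← (permFlag F 1).at_zero]
        exact (permFlag F 1).at_ne_top hn
      have := hx ⊥ hbot
      rw [spaceWeight_bot, sub_zero] at this
      exact pow_ne_zero _ this
  -- Each of the `n` numerators carries a factor `1 / X`, so the required vector is the one of total
  -- `1` divided by `X ^ n`.
  obtain ⟨Φ₀, hΦ₀, hsum⟩ := exists_isStationary (spaceWeight_top x) hx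
  have hΨ : ∀ W, (((∑ i, x i) ^ n)⁻¹ • Φ₀) W = ∏ k ∈ Finset.range n,
        ((spaceWeight x (W.at' (k + 1)) - spaceWeight x (W.at' k)) / (∑ i, x i) /
          (∑ i, x i - spaceWeight x (W.at' k))) := by
    intro W
    rw [Finsupp.smul_apply, hΦ₀.apply_eq hx W, hsum, one_mul, smul_eq_mul]
    simp only [div_right_comm _ (∑ i, x i) _]
    rw [Finset.prod_div_distrib (g := fun _ => ∑ i, x i), Finset.prod_const,
      Finset.card_range, div_eq_inv_mul]
  refine ⟨fun π k => ?_, ((∑ i, x i) ^ n)⁻¹ • Φ₀, ?_, hΨ, fun Φ hΦ => ?_, fun h1 => ?_,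
    fun π V hV V' hV' => ?_, fun π => ?_⟩
  · rw [denFactor_eq]
    exact hx _ ((permFlag F π).at_ne_top k.2)
  · rw [IsStationary, map_smul, show qTsetlin F x Φ₀ = _ from hΦ₀, smul_comm]
  · rw [smul_smul, mul_inv_cancel_right₀ hX]
    ext W
    rw [Finsupp.smul_apply, hΦ.apply_eq hx W, hΦ₀.apply_eq hx W, hsum, one_mul, smul_eq_mul]
  · simp [h1, hsum]
  · simp only [hΨ, spaceWeight_at_of_mem_cell x hV, spaceWeight_at_of_mem_cell x hV']
  · rw [hΨ, Finset.prod_range]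
    simp only [numFactor_eq, denFactor_eq]

/-! ### Positivity and nonvanishing for the two kinds of rates -/

theorem sum_sub_spaceWeight_pos {x : Fin n → ℝ} (hx : ∀ i, 0 < x i)
    {U : Submodule F (Fin n → F)} (hU : U ≠ ⊤) : 0 < ∑ i, x i - spaceWeight x U := by
  rw [sum_sub_spaceWeight]
  have hpos : ∀ i, (0 : ℝ) < leadCount (⊤ : Submodule F (Fin n → F)) i := fun i => by
    rw [leadCount_top]
    exact_mod_cast pow_pos Fintype.card_pos _
  obtain ⟨i, hi⟩ := exists_leadCount_lt hU
  refine Finset.sum_pos' (fun j _ => mul_nonneg (hx j).le ?_) ⟨i, Finset.mem_univ i,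
    mul_pos (hx i) ?_⟩
  · rw [sub_nonneg, div_le_one (hpos j)]
    exact_mod_cast leadCount_mono le_top j
  · rw [sub_pos, div_lt_one (hpos i)]
    exact_mod_cast hi

theorem spaceWeight_mono {x : Fin n → ℝ} (hx : ∀ i, 0 < x i)
    {U U' : Submodule F (Fin n → F)} (h : U ≤ U') : spaceWeight x U ≤ spaceWeight x U' := by
  rw [spaceWeight_eq_sum, spaceWeight_eq_sum]
  refine Finset.sum_le_sum fun i _ => mul_le_mul_of_nonneg_left ?_ ?_
  · exact_mod_cast leadCount_mono h i
  · exact div_nonneg (hx i).le (by positivity)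

theorem sum_sub_spaceWeight_ne_zero {x : Fin n → FractionRing (MvPolynomial (Fin n) ℂ)}
    (hx : ∀ i, x i = algebraMap (MvPolynomial (Fin n) ℂ) _ (MvPolynomial.X i))
    [CharZero (FractionRing (MvPolynomial (Fin n) ℂ))]
    {U : Submodule F (Fin n → F)} (hU : U ≠ ⊤) : ∑ i, x i - spaceWeight x U ≠ 0 := by
  classical
  let c : Fin n → ℂ := fun i =>
    1 - leadCount U i / leadCount (⊤ : Submodule F (Fin n → F)) i
  have hc : ∀ i, algebraMap (MvPolynomial (Fin n) ℂ)
      (FractionRing (MvPolynomial (Fin n) ℂ)) (MvPolynomial.C (c i)) =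
        1 - leadCount U i / leadCount (⊤ : Submodule F (Fin n → F)) i := by
    intro i
    rw [← RingHom.comp_apply, map_sub, map_div₀, map_one, map_natCast, map_natCast]
  have h1 : ∑ i, x i - spaceWeight x U = algebraMap (MvPolynomial (Fin n) ℂ) _
      (∑ i, MvPolynomial.X i * MvPolynomial.C (c i)) := by
    rw [sum_sub_spaceWeight, map_sum]
    exact Finset.sum_congr rfl fun i _ => by rw [map_mul, hc, hx]
  obtain ⟨i, hi⟩ := exists_leadCount_lt hU
  rw [h1, Ne, FaithfulSMul.algebraMap_eq_zero_iff]
  intro h0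
  -- Evaluating the linear form at the `i`-th unit vector isolates its coefficient `c i`, which is
  -- nonzero.
  have h2 := congrArg (MvPolynomial.eval (Pi.single i (1 : ℂ))) h0
  simp only [map_sum, map_mul, MvPolynomial.eval_X, MvPolynomial.eval_C, map_zero,
    Pi.single_apply, ite_mul, one_mul, zero_mul, Finset.sum_ite_eq', Finset.mem_univ,
    if_true, c] at h2
  have hpos : (leadCount (⊤ : Submodule F (Fin n → F)) i : ℂ) ≠ 0 :=
    Nat.cast_ne_zero.mpr (by omega)
  rw [sub_eq_zero, eq_comm, div_eq_one_iff_eq hpos, Nat.cast_inj] at h2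
  omega

end QTsetlin
end
theorem mainTheorem4 (F : Type*) [Field F] [Fintype F] (n : ℕ) :
    -- positive real rates
    (∀ x : Fin n → ℝ, (∀ i, 0 < x i) →
      (∀ (π : Equiv.Perm (Fin n)) (k : Fin n), QTsetlin.denFactor F x π k ≠ 0) ∧
      ∃ Ψ : QTsetlin.CompleteFlag F n →₀ ℝ,
        QTsetlin.IsStationary F x Ψ ∧
        (∀ V, 0 ≤ Ψ V) ∧
        (∀ Φ : QTsetlin.CompleteFlag F n →₀ ℝ, QTsetlin.IsStationary F x Φ →
          ∃ c : ℝ, Φ = c • Ψ) ∧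
        (∀ π : Equiv.Perm (Fin n), ∀ V ∈ QTsetlin.cell F π, ∀ V' ∈ QTsetlin.cell F π,
          Ψ V = Ψ V') ∧
        (∀ π : Equiv.Perm (Fin n), Ψ (QTsetlin.permFlag F π) =
          ∏ k : Fin n, QTsetlin.numFactor F x π k / QTsetlin.denFactor F x π k) ∧
        (∑ i, x i = 1 →
          ∑ V, Ψ V = 1 ∧
          ∀ Φ : QTsetlin.CompleteFlag F n →₀ ℝ, QTsetlin.IsStationary F x Φ →
            ∑ V, Φ V = 1 → Φ = Ψ)) ∧
    -- indeterminate rates, over the field of rational functions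
    (∀ x : Fin n → FractionRing (MvPolynomial (Fin n) ℂ),
      (∀ i, x i = algebraMap (MvPolynomial (Fin n) ℂ) _ (MvPolynomial.X i)) →
      (∀ (π : Equiv.Perm (Fin n)) (k : Fin n), QTsetlin.denFactor F x π k ≠ 0) ∧
      ∃ Ψ : QTsetlin.CompleteFlag F n →₀ FractionRing (MvPolynomial (Fin n) ℂ),
        QTsetlin.IsStationary F x Ψ ∧
        (∀ Φ : QTsetlin.CompleteFlag F n →₀ FractionRing (MvPolynomial (Fin n) ℂ),
          QTsetlin.IsStationary F x Φ →
            ∃ c : FractionRing (MvPolynomial (Fin n) ℂ), Φ = c • Ψ) ∧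
        (∀ π : Equiv.Perm (Fin n), ∀ V ∈ QTsetlin.cell F π, ∀ V' ∈ QTsetlin.cell F π,
          Ψ V = Ψ V') ∧
        (∀ π : Equiv.Perm (Fin n), Ψ (QTsetlin.permFlag F π) =
          ∏ k : Fin n, QTsetlin.numFactor F x π k / QTsetlin.denFactor F x π k)) := by
  have hK : CharZero (FractionRing (MvPolynomial (Fin n) ℂ)) :=
    charZero_of_injective_algebraMap
      (FaithfulSMul.algebraMap_injective (MvPolynomial (Fin n) ℂ) _)
  refine ⟨fun x hx => ?_, fun x hx => ?_⟩
  · obtain ⟨hden, Ψ, h1, h2, h3, h4, h5, h6⟩ := QTsetlin.exists_stationary_formula (F := F)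
      (x := x) fun U hU => (QTsetlin.sum_sub_spaceWeight_pos hx hU).ne'
    refine ⟨hden, Ψ, h1, fun V => ?_, fun Φ hΦ => ⟨_, h3 Φ hΦ⟩, h5, h6, fun hX =>
      ⟨h4 hX, fun Φ hΦ hs => ?_⟩⟩
    · rw [h2]
      refine Finset.prod_nonneg fun k hk => div_nonneg (div_nonneg ?_ ?_) ?_
      · exact sub_nonneg.mpr (QTsetlin.spaceWeight_mono hx (V.at_mono k.le_succ))
      · exact Finset.sum_nonneg fun i _ => (hx i).le
      · exact (QTsetlin.sum_sub_spaceWeight_pos hx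
          (V.at_ne_top (Finset.mem_range.mp hk))).le
    · rw [h3 Φ hΦ, hs, hX, one_pow, one_mul, one_smul]
  · obtain ⟨hden, Ψ, h1, -, h3, -, h5, h6⟩ := QTsetlin.exists_stationary_formula (F := F)
      (x := x) fun U hU => QTsetlin.sum_sub_spaceWeight_ne_zero hx hU
    exact ⟨hden, Ψ, h1, fun Φ hΦ => ⟨_, h3 Φ hΦ⟩, h5, h6⟩
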